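/- **Non-hereditary Goodstein sequences.** For $n\in\mathbb N$ let $G_n:\mathbb N\to\mathbb N$ be given by $G_n(0)=n$ and, for $i\in\mathbb N$: if $G_n(i)=0$, then $G_n(i+1)=0$; if $G_n(i)>0$ has base-$(i+2)$ normal form $$G_n(i)=(i+2)^{e_0}c_0+\dots+(i+2)^{e_k}c_k,\qquad e_0>\dots>e_k,\quad 0<c_j<i+2,$$ then $$G_n(i+1)=(i+3)^{e_0}c_0+\dots+(i+3)^{e_k}c_k-1 .$$ **Arithmetic.** Consider first-order logic with equality over the signature $0,S,+,\times,\le$, with standard model $\mathbb N$. The *$\Sigma$-formulas* are generated from literals (atomic formulas $s=t$, $s\le t$ and their negations) by $\wedge$, $\vee$, bounded quantifiers $\forall x\le t$ and $\exists x\le t$ (where $x$ does not occur in the term $t$), and unbounded quantifiers $\exists x$. The *bounded* formulas are those generated without unbounded quantifiers, and a *$\Sigma_1$-formula* is a formula $\exists x\,\theta$ with $\theta$ bounded. The theory $\mathsf{I\Sigma}_1$ consists of the universal closures of $$Sx=Sy\to x=y,\qquad x\ne 0\leftrightarrow\exists y\;x=Sy,\qquad x\le y\leftrightarrow\exists z\;z+x=y,$$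 $$x+0=x,\qquad x+Sy=S(x+y),\qquad x\times 0=0,\qquad x\times Sy=(x\times y)+x$$ (Robinson arithmetic) and of the universal closures of $$\varphi(0)\wedge\forall x\,\bigl(\varphi(x)\to\varphi(Sx)\bigr)\to\forall x\,\varphi(x)$$ for all $\Sigma_1$-formulas $\varphi(x)$, which may contain further free variables as parameters. We write $\vdash$ for provability in classical first-order logic with equality. **Theorem.** Every non-hereditary Goodstein sequence terminates: for each $n\in\mathbb N$ there is an $i\in\mathbb N$ with $G_n(i)=0$. However, let $\varphi(x,y,z)$ be any $\Sigma$-formula that defines the Goodstein sequences, in the sense that for all $n,i,k\in\mathbb N$ $$G_n(i)=k\quad\Longleftrightarrow\quad\mathbb N\vDash\varphi(n,i,k).$$ Then $\mathsf{I\Sigma}_1\nvdash\forall x\,\exists y\,\varphi(x,y,0)$, i.e. the termination of non-hereditary Goodstein sequences is unprovable in $\mathsf{I\Sigma}_1$. -/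

import Mathlib

/-! ## Goodstein sequences (non-hereditary) -/

/-- `baseChange b m` replaces the base `b` by `b + 1` in the base-`b` normal form of `m`: if
`m = b ^ e₀ * c₀ + … + b ^ eₖ * cₖ` with `e₀ > … > eₖ` and `0 < cᵢ < b`, the value is
`(b + 1) ^ e₀ * c₀ + … + (b + 1) ^ eₖ * cₖ`. (The exponents are not rewritten.) -/
def baseChange (b m : ℕ) : ℕ := Nat.ofDigits (b + 1) (Nat.digits b m)

/-- The non-hereditary Goodstein sequence `i ↦ G_n(i)` with start value `n`. The value `G_n(i)` is
written in base `i + 2`, the base is increased to `i + 3`, and `1` is subtracted; the sequence stays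
at `0` once it has reached `0`. -/
def goodstein (n : ℕ) : ℕ → ℕ
  | 0 => n
  | i + 1 => if goodstein n i = 0 then 0 else baseChange (i + 2) (goodstein n i) - 1

/-! ## The language of first-order arithmetic and its standard model -/

namespace Arithmetic

open FirstOrder FirstOrder.Language

/-- The function symbols `0`, `S`, `+`, `×`. -/
inductive Func : ℕ → Type
  | zero : Func 0
  | succ : Func 1
  | add : Func 2
  | mul : Func 2

/-- The relation symbol `≤`. Equality is part of the logic. -/
inductive Rel : ℕ → Type
  | le : Rel 2

/-- The signature of first-order arithmetic. -/
abbrev arith : Language := ⟨Func, Rel⟩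

variable {α : Type} {n : ℕ}

/-- The term `0`. -/
def zero : arith.Term α := Constants.term (L := arith) Func.zero

/-- The term `S t`. -/
def succ (t : arith.Term α) : arith.Term α := Functions.apply₁ (L := arith) Func.succ t

/-- The term `s + t`. -/
def add (s t : arith.Term α) : arith.Term α := Functions.apply₂ (L := arith) Func.add s t

/-- The term `s × t`. -/
def mul (s t : arith.Term α) : arith.Term α := Functions.apply₂ (L := arith) Func.mul s t

/-- The atomic formula `s ≤ t`. -/
def le (s t : arith.Term (α ⊕ Fin n)) : arith.BoundedFormula α n :=
  Relations.boundedFormula₂ (L := arith) Rel.le s t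

/-- The standard model of arithmetic, with universe `ℕ`. -/
instance standardModel : arith.Structure ℕ where
  funMap {_} f v := match f, v with
    | Func.zero, _ => 0
    | Func.succ, v => v 0 + 1
    | Func.add, v => v 0 + v 1
    | Func.mul, v => v 0 * v 1
  RelMap {_} r v := match r, v with
    | Rel.le, v => v 0 ≤ v 1

/-! ## Bounded formulas and Σ-formulas -/

/-- The formula `∀ x ≤ t, φ`, i.e. `∀ x (x ≤ t → φ)`, where `x` is the variable with index `n`,
which does not occur in `t`. -/
def ballLE (t : arith.Term (α ⊕ Fin n)) (φ : arith.BoundedFormula α (n + 1)) :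
    arith.BoundedFormula α n :=
  ∀' (le (Term.var (Sum.inr (Fin.last n))) (t.relabel (Sum.map id Fin.castSucc)) ⟹ φ)

/-- The formula `∃ x ≤ t, φ`, i.e. `∃ x (x ≤ t ∧ φ)`, where `x` is the variable with index `n`,
which does not occur in `t`. -/
def bexLE (t : arith.Term (α ⊕ Fin n)) (φ : arith.BoundedFormula α (n + 1)) :
    arith.BoundedFormula α n :=
  ∃' (le (Term.var (Sum.inr (Fin.last n))) (t.relabel (Sum.map id Fin.castSucc)) ⊓ φ)

/-- Literals: atomic formulas and negated atomic formulas. -/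
inductive IsLiteral {α : Type} {n : ℕ} : arith.BoundedFormula α n → Prop
  | eq (s t : arith.Term (α ⊕ Fin n)) : IsLiteral (s =' t)
  | not_eq (s t : arith.Term (α ⊕ Fin n)) : IsLiteral (∼(s =' t))
  | le (s t : arith.Term (α ⊕ Fin n)) : IsLiteral (Arithmetic.le s t)
  | not_le (s t : arith.Term (α ⊕ Fin n)) : IsLiteral (∼(Arithmetic.le s t))

/-- Bounded formulas (`Δ₀`-formulas). -/
inductive IsDelta0 {α : Type} : {n : ℕ} → arith.BoundedFormula α n → Prop
  | literal {n : ℕ} {φ : arith.BoundedFormula α n} : IsLiteral φ → IsDelta0 φ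
  | and {n : ℕ} {φ ψ : arith.BoundedFormula α n} : IsDelta0 φ → IsDelta0 ψ → IsDelta0 (φ ⊓ ψ)
  | or {n : ℕ} {φ ψ : arith.BoundedFormula α n} : IsDelta0 φ → IsDelta0 ψ → IsDelta0 (φ ⊔ ψ)
  | ball {n : ℕ} (t : arith.Term (α ⊕ Fin n)) {φ : arith.BoundedFormula α (n + 1)} :
      IsDelta0 φ → IsDelta0 (ballLE t φ)
  | bex {n : ℕ} (t : arith.Term (α ⊕ Fin n)) {φ : arith.BoundedFormula α (n + 1)} :
      IsDelta0 φ → IsDelta0 (bexLE t φ)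

/-- `Σ`-formulas: built like bounded formulas, but with unbounded existential quantifiers
allowed at any place. -/
inductive IsSigma {α : Type} : {n : ℕ} → arith.BoundedFormula α n → Prop
  | literal {n : ℕ} {φ : arith.BoundedFormula α n} : IsLiteral φ → IsSigma φ
  | and {n : ℕ} {φ ψ : arith.BoundedFormula α n} : IsSigma φ → IsSigma ψ → IsSigma (φ ⊓ ψ)
  | or {n : ℕ} {φ ψ : arith.BoundedFormula α n} : IsSigma φ → IsSigma ψ → IsSigma (φ ⊔ ψ)
  | ball {n : ℕ} (t : arith.Term (α ⊕ Fin n)) {φ : arith.BoundedFormula α (n + 1)} :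
      IsSigma φ → IsSigma (ballLE t φ)
  | bex {n : ℕ} (t : arith.Term (α ⊕ Fin n)) {φ : arith.BoundedFormula α (n + 1)} :
      IsSigma φ → IsSigma (bexLE t φ)
  | ex {n : ℕ} {φ : arith.BoundedFormula α (n + 1)} : IsSigma φ → IsSigma (∃' φ)

/-- `Σ₁`-formulas: `∃ x, θ` with `θ` bounded. -/
def IsSigma1 (φ : arith.BoundedFormula α n) : Prop :=
  ∃ θ : arith.BoundedFormula α (n + 1), IsDelta0 θ ∧ φ = ∃' θ

/-! ## The theories `Q` and `IΣ₁` -/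

/-- `φ(t)`, where `φ(x)` is a formula with one distinguished variable `x` (its only variable
of `Fin`-type) and `t` is a term. -/
def inst (φ : arith.BoundedFormula α 1) (t : arith.Term α) : arith.Formula α :=
  φ.toFormula.subst (Sum.elim Term.var fun _ => t)

/-- `φ(S x)`, again as a formula with the distinguished variable `x`. -/
def instSucc (φ : arith.BoundedFormula α 1) : arith.BoundedFormula α 1 :=
  BoundedFormula.relabel (n := 1) id
    (φ.toFormula.subst (Sum.elim (fun a => Term.var (Sum.inl a))
      fun i => succ (Term.var (Sum.inr i))))

/-- The universal closure of a formula whose free variables are indexed by `Fin n`. -/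
def univClosure (φ : arith.Formula (Fin n)) : arith.Sentence :=
  (BoundedFormula.relabel (n := n) (Sum.inr : Fin n → Empty ⊕ Fin n) φ).alls

/-- The induction axiom for `φ(x)`, where `φ` may have parameters indexed by `Fin n`: the universal
closure of `φ(0) ∧ ∀ x (φ(x) → φ(S x)) → ∀ x φ(x)`. -/
def inductionAxiom (φ : arith.BoundedFormula (Fin n) 1) : arith.Sentence :=
  univClosure ((inst φ zero ⊓ ∀' (φ ⟹ instSucc φ)) ⟹ ∀' φ)

/-- Robinson arithmetic. -/
inductive RobinsonQ : arith.Sentence → Prop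
  | succ_inj : RobinsonQ (∀' ∀' ((succ &0 =' succ &1) ⟹ (&0 =' &1)))
  | ne_zero : RobinsonQ (∀' ((∼(&0 =' zero)) ⇔ ∃' (&0 =' succ &1)))
  | le : RobinsonQ (∀' ∀' (Arithmetic.le &0 &1 ⇔ ∃' (add &2 &0 =' &1)))
  | add_zero : RobinsonQ (∀' (add &0 zero =' &0))
  | add_succ : RobinsonQ (∀' ∀' (add &0 (succ &1) =' succ (add &0 &1)))
  | mul_zero : RobinsonQ (∀' (mul &0 zero =' zero))
  | mul_succ : RobinsonQ (∀' ∀' (mul &0 (succ &1) =' add (mul &0 &1) &0))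

/-- The theory `IΣ₁`: Robinson arithmetic together with the induction axioms (with parameters) for
all `Σ₁`-formulas. -/
def ISigma1 : arith.Theory :=
  {ψ | RobinsonQ ψ ∨
    ∃ (n : ℕ) (φ : arith.BoundedFormula (Fin n) 1), IsSigma1 φ ∧ ψ = inductionAxiom φ}

/-! ## Provability -/

/-- `Proves Γ φ`: the formula `φ` is derivable from the assumptions `Γ` by classical natural
deduction with equality. Formulas are built from `⊥`, `→`, `∀` and atomic formulas; the other
connectives are the usual classical abbreviations. In `all_intro` the type `α` of free variables is
extended by one new element, which is the eigenvariable; it is automatically fresh. -/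
inductive Proves : {α : Type} → Set (arith.Formula α) → arith.Formula α → Prop
  | ax {α : Type} {Γ : Set (arith.Formula α)} {φ : arith.Formula α} : φ ∈ Γ → Proves Γ φ
  | imp_intro {α : Type} {Γ : Set (arith.Formula α)} {φ ψ : arith.Formula α} :
      Proves (insert φ Γ) ψ → Proves Γ (φ ⟹ ψ)
  | imp_elim {α : Type} {Γ : Set (arith.Formula α)} {φ ψ : arith.Formula α} :
      Proves Γ (φ ⟹ ψ) → Proves Γ φ → Proves Γ ψ
  | by_contradiction {α : Type} {Γ : Set (arith.Formula α)} {φ : arith.Formula α} :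
      Proves (insert (∼φ) Γ) ⊥ → Proves Γ φ
  | all_intro {α : Type} {Γ : Set (arith.Formula α)} {φ : arith.BoundedFormula α 1} :
      Proves (Formula.relabel (Sum.inl : α → α ⊕ Fin 1) '' Γ) φ.toFormula → Proves Γ (∀' φ)
  | all_elim {α : Type} {Γ : Set (arith.Formula α)} {φ : arith.BoundedFormula α 1}
      (t : arith.Term α) : Proves Γ (∀' φ) → Proves Γ (inst φ t)
  | eq_refl {α : Type} {Γ : Set (arith.Formula α)} (t : arith.Term α) :
      Proves Γ (Term.equal t t)
  | eq_subst {α : Type} {Γ : Set (arith.Formula α)} (φ : arith.BoundedFormula α 1)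
      {s t : arith.Term α} : Proves Γ (Term.equal s t) → Proves Γ (inst φ s) → Proves Γ (inst φ t)

/-! ## Goodstein sequences in arithmetic -/

/-- The formula `φ(x, y, z)` (where `x, y, z` are the variables `0, 1, 2`) defines the Goodstein
sequences: `G_n(i) = k` if and only if `ℕ ⊨ φ(n, i, k)`. -/
def DefinesGoodstein (φ : arith.Formula (Fin 3)) : Prop :=
  ∀ n i k : ℕ, goodstein n i = k ↔ φ.Realize ![n, i, k]

/-- The sentence `∀ x ∃ y φ(x, y, 0)`. -/
def terminationSentence (φ : arith.Formula (Fin 3)) : arith.Sentence :=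
  ∀' ∃' (BoundedFormula.relabel (n := 2) (Sum.inr : Fin 2 → Empty ⊕ Fin 2)
    (φ.subst ![Term.var 0, Term.var 1, zero]))

end Arithmetic

/-!
Termination: by induction on `d`, the digits below position `d` of a Goodstein sequence die out
while the digits above keep their values (`exists_goodstein_eq_pow_mul`). The same analysis gives a
lower bound: to drop a non-zero digit at position `d + 1` by one, a digit at position `d` that is as
large as the base has to be counted down to zero, so the time needed grows with `d` at least as
fast as the Ackermann function (`le_goodstein_digitDropIndex`, `ack_le_digitDropIndex`). Hence, for
each `k`, there is an `s` for which the sequence starting at `s` is non-zero up to the index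
`ack k s` (`exists_goodstein_ne_zero_of_lt_ack`).

Unprovability is shown by a model. Choose such an `s n` for `k = n`. In an ultrapower of `ℕ`, the
elements `s` and `ack n (s n)` are so far apart that all branches `ack k` with standard `k` fit in
between. A semiregular cut in the sense of Kirby and Paris is constructed between them. Its
approximations `aᵢ < bᵢ` from below and above keep a distance of this kind, and at stage `i` one of
countably many functions `gᵢ` is treated: by the pigeonhole principle, `aᵢ₊₁` and `bᵢ₊₁` can be
chosen such that no value of `gᵢ` at arguments up to `aᵢ` lies between them
(`exists_gap_sequences`). The `gᵢ` are the functions that compute least witnesses for bounded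
formulas `θ(p, x, y)`, each of which is treated infinitely often. In the cut below all `bᵢ`,
unbounded quantifiers `∃ y θ(p, x, y)` can thus be replaced by quantifiers bounded by `aᵢ₊₁`, as
long as the arguments are at most `aᵢ` (`realize_ex_iff_eventually`). So `Σ₁`-induction in the cut
reduces to ordinary induction in each coordinate (`cut_realize_inductionAxiom`), and the cut is a
model of `IΣ₁` that contains `s` and lies below `ack n (s n)`.

If `IΣ₁` proved termination, then soundness (`Proves.realize`) would give a `y` in the cut that
satisfies `φ(s, y, 0)`. As `φ` is a `Σ`-formula, this persists to the ultrapower, and by Łoś's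
theorem the sequence starting at `s n` reaches zero at some index below `ack n (s n)` for some `n`,
which contradicts the choice of `s n`.
-/

/-! ### Base change and termination -/

theorem baseChange_eq {b : ℕ} (hb : 2 ≤ b) (m : ℕ) :
    baseChange b m = m % b + (b + 1) * baseChange b (m / b) := by
  rcases Nat.eq_zero_or_pos m with rfl | hm
  · simp [baseChange]
  · unfold baseChange
    rw [Nat.digits_def' hb hm, Nat.ofDigits_cons]

theorem baseChange_add_mul {b r : ℕ} (hb : 2 ≤ b) (hr : r < b) (q : ℕ) :
    baseChange b (r + b * q) = r + (b + 1) * baseChange b q := by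
  rw [baseChange_eq hb, Nat.add_mul_mod_self_left, Nat.mod_eq_of_lt hr,
    Nat.add_mul_div_left _ _ (by omega), Nat.div_eq_of_lt hr, zero_add]

theorem baseChange_pow_mul {b : ℕ} (hb : 2 ≤ b) (d q : ℕ) :
    baseChange b (b ^ d * q) = (b + 1) ^ d * baseChange b q := by
  induction d with
  | zero => simp
  | succ d ih =>
    have := baseChange_add_mul hb (r := 0) (by omega) (b ^ d * q)
    rw [zero_add, zero_add, ih] at this
    rw [pow_succ', pow_succ', mul_assoc, mul_assoc, this]

theorem baseChange_ofDigits {b : ℕ} (hb : 2 ≤ b) {l : List ℕ} (hl : ∀ x ∈ l, x < b) :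
    baseChange b (Nat.ofDigits b l) = Nat.ofDigits (b + 1) l := by
  induction l with
  | nil => simp [baseChange]
  | cons x l ih =>
    rw [Nat.ofDigits_cons, Nat.ofDigits_cons,
      baseChange_add_mul hb (hl x (by simp)), ih fun y hy => hl y (by simp [hy])]

theorem baseChange_strictMono {b : ℕ} (hb : 2 ≤ b) : StrictMono (baseChange b) := by
  intro m m' h
  induction m' using Nat.strong_induction_on generalizing m with
  | _ m' ih =>
    rw [baseChange_eq hb m, baseChange_eq hb m']
    have hr : m % b < b := Nat.mod_lt _ (by omega)
    rcases (Nat.div_le_div_right (c := b) h.le).lt_or_eq with hq | hq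
    · have h1 := ih (m' / b) (Nat.div_lt_self (by omega) (by omega)) hq
      have h2 : (b + 1) * (baseChange b (m / b) + 1) ≤ (b + 1) * baseChange b (m' / b) :=
        Nat.mul_le_mul_left _ h1
      rw [mul_add] at h2
      omega
    · have e1 := Nat.mod_add_div m b
      have e2 := Nat.mod_add_div m' b
      rw [hq] at e1 ⊢
      omega

theorem goodstein_succ {n i : ℕ} (h : goodstein n i ≠ 0) :
    goodstein n (i + 1) = baseChange (i + 2) (goodstein n i) - 1 := by
  simp [goodstein, h]

theorem goodstein_eq_zero_of_le {n i j : ℕ} (h : goodstein n i = 0) (hij : i ≤ j) :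
    goodstein n j = 0 := by
  induction j, hij using Nat.le_induction with
  | base => exact h
  | succ j _ ih => simp [goodstein, ih]

/-- The digits below position `d` die out: if `l` lists the digits of `G_n(i)` from position `d`
on, then the sequence reaches a value with the same digits in these positions and only zeros
below. -/
theorem exists_goodstein_eq_pow_mul (n d : ℕ) : ∀ (i : ℕ) (l : List ℕ) (r : ℕ),
    (∀ x ∈ l, x < i + 2) → r < (i + 2) ^ d →
    goodstein n i = (i + 2) ^ d * Nat.ofDigits (i + 2) l + r →
    ∃ j, i ≤ j ∧ goodstein n j = (j + 2) ^ d * Nat.ofDigits (j + 2) l := by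
  induction d with
  | zero =>
    intro i l r _ hr h
    exact ⟨i, le_rfl, by simp_all⟩
  | succ d ih =>
    -- Once the digits below position `d` are zero, the digit `c` at position `d` is used up.
    have key : ∀ (c i : ℕ) (l : List ℕ), (∀ x ∈ c :: l, x < i + 2) →
        goodstein n i = (i + 2) ^ d * Nat.ofDigits (i + 2) (c :: l) →
        ∃ j, i ≤ j ∧ goodstein n j = (j + 2) ^ (d + 1) * Nat.ofDigits (j + 2) l := by
      intro c
      induction c with
      | zero =>
        intro i l _ h
        refine ⟨i, le_rfl, ?_⟩
        rw [h, Nat.ofDigits_cons]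
        ring
      | succ c ihc =>
        intro i l hl h
        have hne : goodstein n i ≠ 0 := by
          rw [h, Nat.ofDigits_cons]
          positivity
        have h1 : goodstein n (i + 1) =
            (i + 3) ^ d * Nat.ofDigits (i + 3) (c :: l) + ((i + 3) ^ d - 1) := by
          rw [goodstein_succ hne, h, baseChange_pow_mul (by omega),
            baseChange_ofDigits (by omega) hl, Nat.ofDigits_cons, Nat.ofDigits_cons]
          have : 0 < (i + 3) ^ d := by positivity
          rw [← Nat.add_sub_assoc (by omega)]
          congr 1
          ring
        have hl' : ∀ x ∈ c :: l, x < i + 1 + 2 := by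
          intro x hx
          rcases List.mem_cons.1 hx with rfl | hx
          · have := hl (x + 1) (by simp)
            omega
          · have := hl x (by simp [hx])
            omega
        have hpos : 0 < (i + 3) ^ d := by positivity
        obtain ⟨j, hj, hj'⟩ := ih (i + 1) (c :: l) _ hl' (Nat.sub_lt hpos one_pos) h1
        obtain ⟨k, hk, hk'⟩ := ihc j l (fun x hx => (hl' x hx).trans_le (by omega)) hj'
        exact ⟨k, by omega, hk'⟩
    intro i l r hl hr h
    have hpos : 0 < (i + 2) ^ d := by positivity
    have hc : r / (i + 2) ^ d < i + 2 := by
      rw [Nat.div_lt_iff_lt_mul hpos]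
      rwa [pow_succ'] at hr
    have hl' : ∀ x ∈ (r / (i + 2) ^ d) :: l, x < i + 2 := by
      intro x hx
      rcases List.mem_cons.1 hx with rfl | hx
      · exact hc
      · exact hl x hx
    obtain ⟨j, hj, hj'⟩ := ih i ((r / (i + 2) ^ d) :: l) (r % (i + 2) ^ d) hl'
      (Nat.mod_lt _ hpos) (by
        rw [h, Nat.ofDigits_cons]
        conv_lhs => rw [← Nat.div_add_mod r ((i + 2) ^ d)]
        ring)
    obtain ⟨k, hk, hk'⟩ := key _ j l (fun x hx => (hl' x hx).trans_le (by omega)) hj'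
    exact ⟨k, hj.trans hk, hk'⟩

theorem goodstein_terminates (n : ℕ) : ∃ i, goodstein n i = 0 := by
  obtain ⟨j, -, hj⟩ := exists_goodstein_eq_pow_mul n n 0 [] n (by simp)
    (by simpa using Nat.lt_two_pow_self) (by simp [goodstein])
  exact ⟨j, by simpa using hj⟩

/-! ### Ackermannian lower bound -/

/-- A lower bound for the index at which a non-zero digit at position `d` has dropped by one, when
all digits below it are zero at index `i`. Dropping the digit at position `d + 1` creates the
digit `i + 2` at position `d` in base `i + 3`, which then has to drop `i + 2` times. -/
def digitDropIndex : ℕ → ℕ → ℕ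
  | 0, i => i + 1
  | d + 1, i => (digitDropIndex d)^[i + 2] (i + 1)

theorem ack_iterate (k N a : ℕ) : (ack k)^[N] (ack (k + 1) a) = ack (k + 1) (a + N) := by
  induction N with
  | zero => rfl
  | succ N ih => rw [Function.iterate_succ_apply', ih, ← add_assoc, ack_succ_succ]

theorem ack_le_digitDropIndex (d : ℕ) : ∀ i, ack d i ≤ digitDropIndex d i := by
  induction d with
  | zero => intro i; simp [digitDropIndex]
  | succ d ih =>
    intro i
    have h1 : ∀ N x, (ack d)^[N] x ≤ (digitDropIndex d)^[N] x := by
      intro N x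
      induction N with
      | zero => rfl
      | succ N ihN =>
        rw [Function.iterate_succ_apply', Function.iterate_succ_apply']
        exact (ack_mono_right d ihN).trans (ih _)
    calc ack (d + 1) i ≤ ack (d + 1) (0 + (i + 1)) := ack_mono_right _ (by omega)
      _ = (ack d)^[i + 1] (ack (d + 1) 0) := (ack_iterate _ _ _).symm
      _ = (ack d)^[i + 2] 1 := by rw [ack_succ_zero, ← Function.iterate_succ_apply]
      _ ≤ (ack d)^[i + 2] (i + 1) := (ack_mono_right d).iterate _ (by omega)
      _ ≤ _ := h1 _ _

theorem le_digitDropIndex (d i : ℕ) : i ≤ digitDropIndex d i :=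
  (lt_ack_right d i).le.trans (ack_le_digitDropIndex d i)

/-- If `G_n(i)` is at least the number with digits `c + 1, l` from position `d` on and zeros below,
then `G_n` is at least the number with digits `c, l` at the index `digitDropIndex d i`. -/
theorem le_goodstein_digitDropIndex (n d : ℕ) : ∀ (i c : ℕ) (l : List ℕ),
    (∀ x ∈ (c + 1) :: l, x < i + 2) →
    (i + 2) ^ d * Nat.ofDigits (i + 2) ((c + 1) :: l) ≤ goodstein n i →
    (digitDropIndex d i + 2) ^ d * Nat.ofDigits (digitDropIndex d i + 2) (c :: l) ≤
      goodstein n (digitDropIndex d i) := by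
  have step : ∀ (d i c : ℕ) (l : List ℕ), (∀ x ∈ (c + 1) :: l, x < i + 2) →
      (i + 2) ^ d * Nat.ofDigits (i + 2) ((c + 1) :: l) ≤ goodstein n i →
      (i + 3) ^ d * Nat.ofDigits (i + 3) ((c + 1) :: l) ≤ goodstein n (i + 1) + 1 := by
    intro d i c l hl h
    have hne : goodstein n i ≠ 0 := by
      intro h0
      rw [h0, Nat.ofDigits_cons] at h
      have : 0 < (i + 2) ^ d * (c + 1 + (i + 2) * Nat.ofDigits (i + 2) l) := by positivity
      omega
    have := (baseChange_strictMono (b := i + 2) (by omega)).monotone h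
    rw [baseChange_pow_mul (by omega), baseChange_ofDigits (by omega) hl] at this
    rw [goodstein_succ hne]
    exact this.trans (by omega)
  induction d with
  | zero =>
    intro i c l hl h
    have := step 0 i c l hl h
    simp only [digitDropIndex, pow_zero, one_mul, Nat.ofDigits_cons] at this ⊢
    rw [show i + 1 + 2 = i + 3 from rfl]
    omega
  | succ d ih =>
    intro i c l hl h
    have h1 := step (d + 1) i c l hl h
    have hl' : ∀ x ∈ c :: l, x < i + 3 := by
      intro x hx
      rcases List.mem_cons.1 hx with rfl | hx
      · have := hl (x + 1) (by simp)
        omega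
      · have := hl x (by simp [hx])
        omega
    -- The new digit `i + 2` at position `d` after `N` drops.
    have h2 : ∀ N, N ≤ i + 2 → i + 1 ≤ (digitDropIndex d)^[N] (i + 1) ∧
        ((digitDropIndex d)^[N] (i + 1) + 2) ^ d *
          Nat.ofDigits ((digitDropIndex d)^[N] (i + 1) + 2) ((i + 2 - N) :: c :: l) ≤
        goodstein n ((digitDropIndex d)^[N] (i + 1)) := by
      intro N hN
      induction N with
      | zero =>
        refine ⟨le_rfl, ?_⟩
        simp only [Function.iterate_zero, id, Nat.ofDigits_cons] at h1 ⊢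
        rw [show i + 1 + 2 = i + 3 from rfl]
        have : 0 < (i + 3) ^ d := by positivity
        have e : (i + 3) ^ (d + 1) * (c + 1 + (i + 3) * Nat.ofDigits (i + 3) l) =
          (i + 3) ^ d * (i + 2 + (i + 3) * (c + (i + 3) * Nat.ofDigits (i + 3) l)) +
            (i + 3) ^ d := by ring
        simp only [Nat.sub_zero]
        omega
      | succ N ihN =>
        obtain ⟨h3, h4⟩ := ihN (by omega)
        rw [Function.iterate_succ_apply']
        refine ⟨h3.trans (le_digitDropIndex _ _), ?_⟩
        refine ih _ (i + 2 - (N + 1)) (c :: l) ?_ ?_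
        · intro x hx
          rcases List.mem_cons.1 hx with rfl | hx
          · omega
          · have := hl' x hx
            omega
        · rw [show i + 2 - (N + 1) + 1 = i + 2 - N by omega]
          exact h4
    have h3 := (h2 (i + 2) le_rfl).2
    rw [Nat.sub_self, Nat.ofDigits_cons] at h3
    rw [digitDropIndex]
    refine le_trans (le_of_eq ?_) h3
    ring

/-- The length of the Goodstein sequences is not dominated by any branch of the Ackermann
function. -/
theorem exists_goodstein_ne_zero_of_lt_ack (k : ℕ) :
    ∃ s, ∀ i ≤ ack k s, goodstein s i ≠ 0 := by
  set K := max k 3 + 2 with hK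
  set d := K + 2 with hd
  refine ⟨3 * 2 ^ d, fun i hi h0 => ?_⟩
  have h1 : ack k (3 * 2 ^ d) ≤ ack K d := by
    refine (ack_mono_right k ?_).trans (ack_ack_lt_ack_max_add_two k 3 d).le
    have : 0 < 2 ^ d := by positivity
    have h3 : 2 ^ (d + 3) = 2 ^ d * 8 := pow_add 2 d 3
    rw [ack_three]
    omega
  have h2 : ack K d ≤ ack d 0 := by
    have h3 : d ≤ ack (K + 1) 0 := add_lt_ack (K + 1) 0
    rw [show ack d 0 = ack K (ack (K + 1) 0) by rw [hd, ack_succ_zero, ack_succ_succ]]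
    exact ack_mono_right K h3
  have h4 := le_goodstein_digitDropIndex (3 * 2 ^ d) d 0 0 [1] (by simp)
    (by simp [goodstein, Nat.ofDigits_cons, mul_comm])
  rw [goodstein_eq_zero_of_le h0 ((hi.trans (h1.trans h2)).trans (ack_le_digitDropIndex d 0)),
    Nat.ofDigits_cons, Nat.ofDigits_singleton] at h4
  have : 0 < (digitDropIndex d 0 + 2) ^ d * (0 + (digitDropIndex d 0 + 2) * 1) := by positivity
  omega

namespace Arithmetic

open FirstOrder FirstOrder.Language

/-! ### Soundness of the calculus -/

section Semantics

variable {α : Type} {n : ℕ} {M : Type*} [arith.Structure M]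

theorem realize_zero (v : α → M) :
    (zero : arith.Term α).realize v = Structure.funMap (L := arith) Func.zero ![] := by
  simp only [zero, Constants.term, Term.realize]
  congr 1
  exact Subsingleton.elim _ _

theorem realize_inst {φ : arith.BoundedFormula α 1} {t : arith.Term α} {v : α → M} :
    (inst φ t).Realize v ↔ φ.Realize v fun _ => t.realize v := by
  rw [inst, Formula.Realize, BoundedFormula.realize_subst, ← Formula.Realize,
    BoundedFormula.realize_toFormula]
  rfl

theorem realize_instSucc {φ : arith.BoundedFormula α 1} {v : α → M} {xs : Fin 1 → M} :
    (instSucc φ).Realize v xs ↔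
      φ.Realize v fun _ => Structure.funMap (L := arith) Func.succ ![xs 0] := by
  have key : ∀ (w : α ⊕ Fin 1 → M) (ys : Fin 0 → M),
      BoundedFormula.Realize φ.toFormula w ys ↔ φ.Realize (w ∘ Sum.inl) (w ∘ Sum.inr) := by
    intro w ys
    rw [Subsingleton.elim ys default]
    exact BoundedFormula.realize_toFormula φ w
  have h : ∀ i : Fin 1, xs i = xs 0 := fun i => congrArg xs (Subsingleton.elim _ _)
  refine BoundedFormula.realize_relabel.trans (BoundedFormula.realize_subst.trans ?_)
  rw [key]
  simp [Function.comp_def, succ, h]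

theorem realize_all_iff {φ : arith.BoundedFormula α 1} {v : α → M} :
    Formula.Realize (∀' φ) v ↔ ∀ x : M, φ.Realize v fun _ => x := by
  rw [Formula.Realize, BoundedFormula.realize_all]
  refine forall_congr' fun x => ?_
  rw [show (Fin.snoc default x : Fin 1 → M) = fun _ => x from
    funext fun i => by rw [Subsingleton.elim (α := Fin 1) i (Fin.last 0), Fin.snoc_last] ]

/-- The calculus is sound for all structures over the signature of arithmetic. -/
theorem Proves.realize {Γ : Set (arith.Formula α)} {φ : arith.Formula α} (h : Proves Γ φ) :
    ∀ v : α → M, (∀ ψ ∈ Γ, ψ.Realize v) → φ.Realize v := by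
  induction h with
  | ax h => exact fun v hv => hv _ h
  | imp_intro _ ih =>
    intro v hv
    refine BoundedFormula.realize_imp.2 fun h => ih v ?_
    rintro ψ (rfl | hψ)
    · exact h
    · exact hv ψ hψ
  | imp_elim _ _ ih₁ ih₂ =>
    exact fun v hv => BoundedFormula.realize_imp.1 (ih₁ v hv) (ih₂ v hv)
  | by_contradiction _ ih =>
    intro v hv
    by_contra h
    refine ih v ?_
    rintro ψ (rfl | hψ)
    · exact h
    · exact hv ψ hψ
  | @all_intro α Γ φ _ ih =>
    intro v hv
    refine realize_all_iff.2 fun x => ?_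
    have := ih (Sum.elim v fun _ => x) (by
      rintro _ ⟨ψ, hψ, rfl⟩
      exact Formula.realize_relabel.2 (hv ψ hψ))
    rwa [BoundedFormula.realize_toFormula] at this
  | all_elim t _ ih => exact fun v hv => realize_inst.2 (realize_all_iff.1 (ih v hv) _)
  | eq_refl t => exact fun v _ => Formula.realize_equal.2 rfl
  | eq_subst φ _ _ ih₁ ih₂ =>
    intro v hv
    rw [realize_inst, ← Formula.realize_equal.1 (ih₁ v hv), ← realize_inst]
    exact ih₂ v hv

theorem realize_univClosure {φ : arith.Formula (Fin n)} :
    M ⊨ univClosure φ ↔ ∀ v : Fin n → M, φ.Realize v := by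
  refine BoundedFormula.realize_alls.trans ?_
  exact forall_congr' fun v => Formula.realize_relabel_sumInr φ

theorem realize_inductionAxiom {φ : arith.BoundedFormula (Fin n) 1} :
    M ⊨ inductionAxiom φ ↔ ∀ v : Fin n → M,
      (φ.Realize v fun _ => Structure.funMap (L := arith) Func.zero ![]) →
      (∀ x : M, (φ.Realize v fun _ => x) →
        φ.Realize v fun _ => Structure.funMap (L := arith) Func.succ ![x]) →
      ∀ x : M, φ.Realize v fun _ => x := by
  rw [inductionAxiom, realize_univClosure]
  refine forall_congr' fun v => ?_
  rw [Formula.Realize, BoundedFormula.realize_imp, BoundedFormula.realize_inf, and_imp,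
    ← Formula.Realize, ← Formula.Realize, ← Formula.Realize, realize_inst, realize_all_iff,
    realize_all_iff]
  simp only [BoundedFormula.realize_imp, realize_instSucc]
  rw [realize_zero]

theorem realize_terminationSentence {φ : arith.Formula (Fin 3)} :
    M ⊨ terminationSentence φ ↔ ∀ x : M, ∃ y : M,
      φ.Realize ![x, y, Structure.funMap (L := arith) Func.zero ![] ] := by
  rw [terminationSentence, Sentence.Realize, Formula.Realize, BoundedFormula.realize_all]
  refine forall_congr' fun x => ?_
  rw [BoundedFormula.realize_ex]
  refine exists_congr fun y => ?_
  rw [Formula.realize_relabel_sumInr, Formula.Realize, BoundedFormula.realize_subst,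
    ← Formula.Realize]
  refine iff_of_eq (congrArg _ (funext fun i => ?_))
  fin_cases i
  · rfl
  · rfl
  · exact realize_zero _

/-! ### Initial segments -/

theorem realize_ballLE {t : arith.Term (α ⊕ Fin n)} {φ : arith.BoundedFormula α (n + 1)}
    {v : α → M} {xs : Fin n → M} :
    (ballLE t φ).Realize v xs ↔
      ∀ x : M, Structure.RelMap (L := arith) Rel.le ![x, t.realize (Sum.elim v xs)] →
        φ.Realize v (Fin.snoc xs x) := by
  have h : ∀ x : M, Sum.elim v (Fin.snoc xs x) ∘ Sum.map id Fin.castSucc = Sum.elim v xs := by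
    intro x
    ext (i | i) <;> simp
  simp [ballLE, le, BoundedFormula.realize_rel₂, Term.realize_relabel, h]

theorem realize_bexLE {t : arith.Term (α ⊕ Fin n)} {φ : arith.BoundedFormula α (n + 1)}
    {v : α → M} {xs : Fin n → M} :
    (bexLE t φ).Realize v xs ↔
      ∃ x : M, Structure.RelMap (L := arith) Rel.le ![x, t.realize (Sum.elim v xs)] ∧
        φ.Realize v (Fin.snoc xs x) := by
  have h : ∀ x : M, Sum.elim v (Fin.snoc xs x) ∘ Sum.map id Fin.castSucc = Sum.elim v xs := by
    intro x
    ext (i | i) <;> simp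
  simp [bexLE, le, BoundedFormula.realize_rel₂, Term.realize_relabel, h]

variable {S : arith.Substructure M}

theorem realize_coe_term (t : arith.Term (α ⊕ Fin n)) (v : α → S) (xs : Fin n → S) :
    t.realize (Sum.elim (fun a => (v a : M)) fun i => (xs i : M)) =
      (t.realize (Sum.elim v xs) : S) := by
  have h := HomClass.realize_term S.subtype (t := t) (v := Sum.elim v xs)
  rw [Substructure.coe_subtype] at h
  rw [← h]
  congr 1
  ext (i | i) <;> rfl

theorem coe_snoc (xs : Fin n → S) (x : S) :
    (fun i => ((Fin.snoc xs x : Fin (n + 1) → S) i : M)) = Fin.snoc (fun i => (xs i : M)) (x : M) :=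
  Fin.comp_snoc (Subtype.val : S → M) xs x

theorem relMap_le_coe (x y : S) :
    Structure.RelMap (L := arith) Rel.le ![(x : M), (y : M)] ↔
      Structure.RelMap (L := arith) Rel.le ![x, y] := by
  rw [← S.subtype.map_rel]
  refine iff_of_eq (congrArg _ (funext fun i => ?_))
  fin_cases i <;> rfl

theorem IsLiteral.realize_coe {φ : arith.BoundedFormula α n} (h : IsLiteral φ) (v : α → S)
    (xs : Fin n → S) :
    φ.Realize (fun a => (v a : M)) (fun i => (xs i : M)) ↔ φ.Realize v xs := by
  cases h with
  | eq s t => simp [realize_coe_term]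
  | not_eq s t => simp [realize_coe_term]
  | le s t => simp [Arithmetic.le, BoundedFormula.realize_rel₂, realize_coe_term, relMap_le_coe]
  | not_le s t => simp [Arithmetic.le, BoundedFormula.realize_rel₂, realize_coe_term, relMap_le_coe]

/-- Bounded formulas are absolute between a structure and its initial segments. -/
theorem IsDelta0.realize_coe
    (hS : ∀ x ∈ S, ∀ y : M, Structure.RelMap (L := arith) Rel.le ![y, x] → y ∈ S)
    {φ : arith.BoundedFormula α n} (h : IsDelta0 φ) (v : α → S) (xs : Fin n → S) :
    φ.Realize (fun a => (v a : M)) (fun i => (xs i : M)) ↔ φ.Realize v xs := by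
  induction h with
  | literal h => exact h.realize_coe v xs
  | and _ _ ih₁ ih₂ => rw [BoundedFormula.realize_inf, BoundedFormula.realize_inf, ih₁, ih₂]
  | or _ _ ih₁ ih₂ => rw [BoundedFormula.realize_sup, BoundedFormula.realize_sup, ih₁, ih₂]
  | ball t _ ih =>
    rw [realize_ballLE, realize_ballLE, realize_coe_term]
    refine ⟨fun h x hx => ?_, fun h x hx => ?_⟩
    · rw [← ih, coe_snoc]
      exact h x ((relMap_le_coe _ _).2 hx)
    · lift x to S using hS _ (Subtype.prop _) x hx
      rw [← coe_snoc, ih]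
      exact h x ((relMap_le_coe _ _).1 hx)
  | bex t _ ih =>
    rw [realize_bexLE, realize_bexLE, realize_coe_term]
    constructor
    · rintro ⟨x, hx, h⟩
      lift x to S using hS _ (Subtype.prop _) x hx
      rw [← coe_snoc, ih] at h
      exact ⟨x, (relMap_le_coe _ _).1 hx, h⟩
    · rintro ⟨x, hx, h⟩
      rw [← ih, coe_snoc] at h
      exact ⟨x, (relMap_le_coe _ _).2 hx, h⟩

/-- `Σ`-formulas persist from an initial segment to the whole structure. -/
theorem IsSigma.realize_coe
    (hS : ∀ x ∈ S, ∀ y : M, Structure.RelMap (L := arith) Rel.le ![y, x] → y ∈ S)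
    {φ : arith.BoundedFormula α n} (h : IsSigma φ) (v : α → S) (xs : Fin n → S) :
    φ.Realize v xs → φ.Realize (fun a => (v a : M)) fun i => (xs i : M) := by
  induction h with
  | literal h => exact (h.realize_coe v xs).2
  | and _ _ ih₁ ih₂ =>
    rw [BoundedFormula.realize_inf, BoundedFormula.realize_inf]
    exact And.imp (ih₁ xs) (ih₂ xs)
  | or _ _ ih₁ ih₂ =>
    rw [BoundedFormula.realize_sup, BoundedFormula.realize_sup]
    exact Or.imp (ih₁ xs) (ih₂ xs)
  | ball t _ ih =>
    rw [realize_ballLE, realize_ballLE, realize_coe_term]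
    intro h x hx
    lift x to S using hS _ (Subtype.prop _) x hx
    rw [← coe_snoc]
    exact ih _ (h x ((relMap_le_coe _ _).1 hx))
  | bex t _ ih =>
    rw [realize_bexLE, realize_bexLE, realize_coe_term]
    rintro ⟨x, hx, h⟩
    refine ⟨x, (relMap_le_coe _ _).2 hx, ?_⟩
    rw [← coe_snoc]
    exact ih _ h
  | ex _ ih =>
    rw [BoundedFormula.realize_ex, BoundedFormula.realize_ex]
    rintro ⟨x, h⟩
    refine ⟨x, ?_⟩
    rw [← coe_snoc]
    exact ih _ h

end Semantics
end Arithmetic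

/-! ### Gaps between fast growing numbers -/

/-- Three levels of the Ackermann function absorb polynomially many iterations. -/
theorem exists_pow_add_iterate_ack_le (m : ℕ) : ∃ c, ∀ k, c ≤ k → ∀ a,
    (a + 1) ^ 2 ≤ ack k a ∧ (ack k)^[(a + 1) ^ m + 2] a ≤ ack (k + 3) a := by
  have hp : ∀ m, ∃ c, ∀ a, a + ((a + 1) ^ m + 2) < ack c a := by
    intro m
    refine exists_lt_ack_of_nat_primrec (Primrec.nat_iff.1 ?_)
    have hpow : Primrec fun a : ℕ => (a + 1) ^ m := by
      induction m with
      | zero => simpa using Primrec.const 1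
      | succ m ih =>
        simp only [pow_succ]
        exact Primrec.nat_mul.comp ih Primrec.succ
    exact Primrec.nat_add.comp Primrec.id (Primrec.nat_add.comp hpow (Primrec.const 2))
  obtain ⟨c, hc⟩ := hp m
  obtain ⟨c₂, hc₂⟩ := hp 2
  refine ⟨max c c₂, fun k hk a => ⟨?_, ?_⟩⟩
  · have h1 := hc₂ a
    have h2 := ack_mono_left a ((le_max_right c c₂).trans hk)
    dsimp only at h2
    omega
  · calc (ack k)^[(a + 1) ^ m + 2] a
        ≤ (ack k)^[(a + 1) ^ m + 2] (ack (k + 1) a) :=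
          (ack_mono_right k).iterate _ (lt_ack_right _ _).le
      _ = ack (k + 1) (a + ((a + 1) ^ m + 2)) := ack_iterate _ _ _
      _ ≤ ack (k + 1) (ack c a) := ack_mono_right _ (hc a).le
      _ ≤ ack (max (k + 1) c + 2) a := (ack_ack_lt_ack_max_add_two _ _ _).le
      _ = ack (k + 3) a := by
        rw [max_eq_left (((le_max_left c c₂).trans hk).trans (Nat.le_succ k))]

/-- Pigeonhole principle: of the `N` intervals between consecutive iterates of `ack k`, one
contains no element of a set with less than `N` elements. -/
theorem exists_gap_of_card_lt {V : Finset ℕ} {N k a b : ℕ} (hV : V.card < N)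
    (h : (ack k)^[N + 1] a ≤ b) :
    ∃ a' b', ack k a ≤ a' ∧ ack k a' ≤ b' ∧ b' ≤ b ∧ ∀ v ∈ V, v < a' ∨ b' ≤ v := by
  have hmono : Monotone fun j => (ack k)^[j] a :=
    monotone_nat_of_le_succ fun j => by
      rw [Function.iterate_succ_apply']
      exact (lt_ack_right _ _).le
  have h1 : ∃ j < N, ∀ v ∈ V, v < (ack k)^[j + 1] a ∨ (ack k)^[j + 2] a ≤ v := by
    by_contra! hcon
    have hcon' : ∀ j, ∃ v, j < N → v ∈ V ∧ (ack k)^[j + 1] a ≤ v ∧ v < (ack k)^[j + 2] a := by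
      intro j
      by_cases hj : j < N
      · obtain ⟨v, hv⟩ := hcon j hj
        exact ⟨v, fun _ => hv⟩
      · exact ⟨0, fun h => (hj h).elim⟩
    choose f hf using hcon'
    have hlt : ∀ i j, i < j → j < N → f i < f j := by
      intro i j hij hj
      have h2 := (hf i (hij.trans hj)).2.2
      have h3 := (hf j hj).2.1
      have h4 : (ack k)^[i + 2] a ≤ (ack k)^[j + 1] a := hmono (by omega)
      omega
    have hinj : Set.InjOn f (Finset.range N) := by
      intro i hi j hj hij
      rw [Finset.mem_coe, Finset.mem_range] at hi hj
      rcases lt_trichotomy i j with h | h | h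
      · exact absurd hij (hlt i j h hj).ne
      · exact h
      · exact absurd hij (hlt j i h hi).ne'
    have h5 := Finset.card_le_card_of_injOn (s := Finset.range N) (t := V) f
      (fun j hj => (hf j (Finset.mem_range.1 hj)).1) hinj
    rw [Finset.card_range] at h5
    omega
  obtain ⟨j, hj, hjV⟩ := h1
  refine ⟨(ack k)^[j + 1] a, (ack k)^[j + 2] a, hmono (show 1 ≤ j + 1 by omega), ?_,
    le_trans (hmono (show j + 2 ≤ N + 1 by omega)) h, hjV⟩
  exact (Function.iterate_succ_apply' (ack k) (j + 1) a).ge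

/-- A sufficiently large interval contains a large subinterval that avoids all values of a given
function `g` at arguments below the interval. -/
theorem exists_gap_of_function {m : ℕ} (g : (Fin m → ℕ) → ℕ → ℕ) :
    ∃ c, ∀ k, c ≤ k → ∀ a b, ack (k + 3) a ≤ b →
      ∃ a' b', (a + 1) ^ 2 ≤ a' ∧ ack k a' ≤ b' ∧ b' ≤ b ∧
        ∀ p x, (∀ j, p j ≤ a) → x ≤ a → g p x < a' ∨ b' ≤ g p x := by
  obtain ⟨c, hc⟩ := exists_pow_add_iterate_ack_le (m + 1)
  refine ⟨c, fun k hk a b hab => ?_⟩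
  let V : Finset ℕ := Finset.univ.image fun q : (Fin m → Fin (a + 1)) × Fin (a + 1) =>
    g (fun j => q.1 j) q.2
  have hV : V.card < (a + 1) ^ (m + 1) + 1 := by
    refine Nat.lt_succ_of_le (Finset.card_image_le.trans ?_)
    simp [pow_succ]
  obtain ⟨a', b', h1, h2, h3, h4⟩ := exists_gap_of_card_lt hV (((hc k hk a).2).trans hab)
  refine ⟨a', b', (hc k hk a).1.trans h1, h2, h3, fun p x hp hx => h4 _ ?_⟩
  exact Finset.mem_image.2 ⟨(fun j => ⟨p j, Nat.lt_succ_of_le (hp j)⟩, ⟨x, Nat.lt_succ_of_le hx⟩),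
    Finset.mem_univ _, rfl⟩

open Filter

/-- Sequences `aᵢ(n)` and `bᵢ(n)` that represent, modulo an ultrafilter on the indices `n`, an
increasing and a decreasing sequence of non-standard numbers with `aᵢ < bᵢ`, such that no value of
the function `gᵢ` at arguments up to `aᵢ` lies in the interval from `aᵢ₊₁` to `bᵢ₊₁`. -/
theorem exists_gap_sequences (g : ℕ → Σ m, (Fin m → ℕ) → ℕ → ℕ) (a₀ b₀ : ℕ → ℕ)
    (h₀ : ∀ n, ack n (a₀ n) ≤ b₀ n) :
    ∃ a b : ℕ → ℕ → ℕ, a 0 = a₀ ∧ b 0 = b₀ ∧ ∀ i, ∀ᶠ n in atTop,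
      (a i n + 1) ^ 2 ≤ a (i + 1) n ∧ a i n < b i n ∧ b (i + 1) n ≤ b i n ∧
      ∀ p x, (∀ j, p j ≤ a i n) → x ≤ a i n →
        (g i).2 p x < a (i + 1) n ∨ b (i + 1) n ≤ (g i).2 p x := by
  -- The distance is a level `K n` that tends to infinity; each stage uses up three levels.
  let Inv : (ℕ → ℕ) × (ℕ → ℕ) → Prop := fun s =>
    ∃ K : ℕ → ℕ, Tendsto K atTop atTop ∧ ∀ᶠ n in atTop, ack (K n) (s.1 n) ≤ s.2 n
  have hstep : ∀ (i : ℕ) (s : {s // Inv s}), ∃ t : {s // Inv s}, ∀ᶠ n in atTop,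
      (s.1.1 n + 1) ^ 2 ≤ t.1.1 n ∧ s.1.1 n < s.1.2 n ∧ t.1.2 n ≤ s.1.2 n ∧
      ∀ p x, (∀ j, p j ≤ s.1.1 n) → x ≤ s.1.1 n →
        (g i).2 p x < t.1.1 n ∨ t.1.2 n ≤ (g i).2 p x := by
    rintro i ⟨⟨a, b⟩, K, hK, hab⟩
    obtain ⟨c, hc⟩ := exists_gap_of_function (g i).2
    have h1 : ∀ n, ∃ a' b', c + 3 ≤ K n → ack (K n) (a n) ≤ b n →
        (a n + 1) ^ 2 ≤ a' ∧ ack (K n - 3) a' ≤ b' ∧ b' ≤ b n ∧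
        ∀ p x, (∀ j, p j ≤ a n) → x ≤ a n → (g i).2 p x < a' ∨ b' ≤ (g i).2 p x := by
      intro n
      by_cases h : c + 3 ≤ K n ∧ ack (K n) (a n) ≤ b n
      · obtain ⟨a', b', h'⟩ := hc (K n - 3) (by omega) (a n) (b n)
          (by rw [Nat.sub_add_cancel (by omega)]; exact h.2)
        exact ⟨a', b', fun _ _ => h'⟩
      · exact ⟨0, 0, fun h1 h2 => (h ⟨h1, h2⟩).elim⟩
    choose a' b' h' using h1
    have hK' := hK.eventually_ge_atTop (c + 3)
    refine ⟨⟨(a', b'), fun n => K n - 3, ?_, ?_⟩, ?_⟩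
    · exact (tendsto_sub_atTop_nat 3).comp hK
    · filter_upwards [hab, hK'] with n h1 h2 using (h' n h2 h1).2.1
    · filter_upwards [hab, hK'] with n h1 h2
      obtain ⟨h3, -, h4, h5⟩ := h' n h2 h1
      exact ⟨h3, (lt_ack_right _ _).trans_le h1, h4, h5⟩
  choose step hs using hstep
  let F : ℕ → {s // Inv s} := fun i =>
    Nat.rec ⟨(a₀, b₀), id, tendsto_id, Eventually.of_forall h₀⟩ step i
  exact ⟨fun i => (F i).1.1, fun i => (F i).1.2, rfl, rfl, fun i => hs i (F i)⟩

namespace Arithmetic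

open FirstOrder FirstOrder.Language Filter

/-! ### Cuts in an ultrapower of the standard model -/

/-- The ultrapower of the standard model with respect to a non-principal ultrafilter on `ℕ`. -/
noncomputable abbrev Ultrapower : Type :=
  ((hyperfilter ℕ : Ultrafilter ℕ) : Filter ℕ).Product fun _ : ℕ => ℕ

/-- The element of the ultrapower that is represented by a sequence of natural numbers. -/
noncomputable def germ (f : ℕ → ℕ) : Ultrapower := Quotient.mk _ f

theorem exists_eq_germ (x : Ultrapower) : ∃ f, x = germ f :=
  Quotient.inductionOn x fun f => ⟨f, rfl⟩

theorem germ_eq_germ {f g : ℕ → ℕ} :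
    germ f = germ g ↔ ∀ᶠ n in (hyperfilter ℕ : Filter ℕ), f n = g n :=
  Quotient.eq''

/-- Łoś's theorem. -/
theorem realize_germ {α : Type} {k : ℕ} (φ : arith.BoundedFormula α k) (v : α → ℕ → ℕ)
    (xs : Fin k → ℕ → ℕ) :
    φ.Realize (fun i => germ (v i)) (fun j => germ (xs j)) ↔
      ∀ᶠ n in (hyperfilter ℕ : Filter ℕ), φ.Realize (fun i => v i n) fun j => xs j n :=
  Ultraproduct.boundedFormula_realize_cast (u := hyperfilter ℕ) (M := fun _ => ℕ) φ v xs

theorem funMap_germ {k : ℕ} (F : arith.Functions k) (v : Fin k → ℕ → ℕ) :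
    Structure.funMap F (fun j => germ (v j)) =
      germ fun n => Structure.funMap F fun j => v j n :=
  Ultraproduct.funMap_cast (u := hyperfilter ℕ) (M := fun _ => ℕ) F v

theorem relMap_le_germ (f g : ℕ → ℕ) :
    Structure.RelMap (L := arith) Rel.le ![germ f, germ g] ↔
      ∀ᶠ n in (hyperfilter ℕ : Filter ℕ), f n ≤ g n := by
  have h := realize_germ (Arithmetic.le (α := Fin 2) (n := 0) (Term.var (Sum.inl 0))
    (Term.var (Sum.inl 1))) ![f, g] default
  simpa [Arithmetic.le, BoundedFormula.realize_rel₂, Structure.RelMap] using h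

theorem zero_germ : Structure.funMap (L := arith) Func.zero ![] = germ fun _ => 0 := by
  rw [Subsingleton.elim (α := Fin 0 → Ultrapower) ![] fun j => germ ((![] : Fin 0 → ℕ → ℕ) j)]
  exact funMap_germ Func.zero _

theorem succ_germ (f : ℕ → ℕ) :
    Structure.funMap (L := arith) Func.succ ![germ f] = germ fun n => f n + 1 := by
  rw [show ![germ f] = fun j => germ (![f] j) from funext fun j => by fin_cases j; rfl]
  exact funMap_germ Func.succ _

theorem add_germ (f g : ℕ → ℕ) :
    Structure.funMap (L := arith) Func.add ![germ f, germ g] = germ fun n => f n + g n := by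
  rw [show ![germ f, germ g] = fun j => germ (![f, g] j) from
    funext fun j => by fin_cases j <;> rfl]
  exact funMap_germ Func.add _

theorem mul_germ (f g : ℕ → ℕ) :
    Structure.funMap (L := arith) Func.mul ![germ f, germ g] = germ fun n => f n * g n := by
  rw [show ![germ f, germ g] = fun j => germ (![f, g] j) from
    funext fun j => by fin_cases j <;> rfl]
  exact funMap_germ Func.mul _

variable {a : ℕ → ℕ → ℕ}

theorem eventually_le_of_le
    (ha : ∀ i, ∀ᶠ n in (hyperfilter ℕ : Filter ℕ), (a i n + 1) ^ 2 ≤ a (i + 1) n) {i j : ℕ}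
    (hij : i ≤ j) : ∀ᶠ n in (hyperfilter ℕ : Filter ℕ), a i n ≤ a j n := by
  induction j, hij using Nat.le_induction with
  | base => exact Eventually.of_forall fun _ => le_rfl
  | succ j _ ih => filter_upwards [ih, ha j] with n h1 h2 using by nlinarith

/-- The initial segment of the ultrapower whose elements lie below some element of the increasing
sequence represented by `a`. -/
noncomputable def cut (a : ℕ → ℕ → ℕ)
    (ha : ∀ i, ∀ᶠ n in (hyperfilter ℕ : Filter ℕ), (a i n + 1) ^ 2 ≤ a (i + 1) n) :
    arith.Substructure Ultrapower where
  carrier := {x | ∃ f i, x = germ f ∧ ∀ᶠ n in (hyperfilter ℕ : Filter ℕ), f n ≤ a i n}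
  fun_mem {k} F xs hxs := by
    choose f i hf hi using hxs
    obtain ⟨N, hN⟩ : ∃ N, ∀ j, i j ≤ N := (Set.finite_range i).bddAbove.imp fun N hN j =>
      hN (Set.mem_range_self j)
    have hall : ∀ᶠ n in (hyperfilter ℕ : Filter ℕ), ∀ j, f j n ≤ a N n :=
      eventually_all.2 fun j => (hi j).and (eventually_le_of_le ha (hN j)) |>.mono
        fun n h => h.1.trans h.2
    refine ⟨_, N + 1, by rw [funext hf, funMap_germ], ?_⟩
    filter_upwards [hall, ha N] with n h1 h2
    refine le_trans ?_ h2
    cases F with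
    | zero => exact Nat.zero_le _
    | succ =>
      have := h1 0
      show f 0 n + 1 ≤ _
      nlinarith
    | add =>
      have := h1 0
      have := h1 1
      show f 0 n + f 1 n ≤ _
      nlinarith
    | mul =>
      show f 0 n * f 1 n ≤ _
      exact (Nat.mul_le_mul (h1 0) (h1 1)).trans (by nlinarith)

variable {ha : ∀ i, ∀ᶠ n in (hyperfilter ℕ : Filter ℕ), (a i n + 1) ^ 2 ≤ a (i + 1) n}

theorem germ_mem_cut {f : ℕ → ℕ} :
    germ f ∈ cut a ha ↔ ∃ i, ∀ᶠ n in (hyperfilter ℕ : Filter ℕ), f n ≤ a i n := by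
  constructor
  · rintro ⟨g, i, hfg, hg⟩
    refine ⟨i, ?_⟩
    filter_upwards [germ_eq_germ.1 hfg, hg] with n h1 h2
    rwa [h1]
  · rintro ⟨i, hi⟩
    exact ⟨f, i, rfl, hi⟩

theorem germ_mem_cut_of_le {f g : ℕ → ℕ} (hg : germ g ∈ cut a ha)
    (h : ∀ᶠ n in (hyperfilter ℕ : Filter ℕ), f n ≤ g n) : germ f ∈ cut a ha := by
  obtain ⟨i, hi⟩ := germ_mem_cut.1 hg
  exact germ_mem_cut.2 ⟨i, h.and hi |>.mono fun n h => h.1.trans h.2⟩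

theorem mem_cut_of_relMap_le : ∀ x ∈ cut a ha, ∀ y : Ultrapower,
    Structure.RelMap (L := arith) Rel.le ![y, x] → y ∈ cut a ha := by
  intro x hx y hyx
  obtain ⟨f, rfl⟩ := exists_eq_germ x
  obtain ⟨g, rfl⟩ := exists_eq_germ y
  exact germ_mem_cut_of_le hx ((relMap_le_germ _ _).1 hyx)

theorem coe_funMap {k : ℕ} (F : arith.Functions k) (xs : Fin k → cut a ha) :
    ((Structure.funMap F xs : cut a ha) : Ultrapower) = Structure.funMap F fun j => (xs j : _) :=
  rfl

theorem coe_zero : ((Structure.funMap (L := arith) Func.zero ![] : cut a ha) : Ultrapower) =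
    germ fun _ => 0 := by
  rw [coe_funMap, ← zero_germ]
  congr 1

theorem coe_succ (x : cut a ha) :
    ((Structure.funMap (L := arith) Func.succ ![x] : cut a ha) : Ultrapower) =
      Structure.funMap (L := arith) Func.succ ![(x : Ultrapower)] := by
  rw [coe_funMap]
  congr 1

theorem coe_add (x y : cut a ha) :
    ((Structure.funMap (L := arith) Func.add ![x, y] : cut a ha) : Ultrapower) =
      Structure.funMap (L := arith) Func.add ![(x : Ultrapower), (y : Ultrapower)] := by
  rw [coe_funMap]
  congr 1

theorem coe_mul (x y : cut a ha) :
    ((Structure.funMap (L := arith) Func.mul ![x, y] : cut a ha) : Ultrapower) =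
      Structure.funMap (L := arith) Func.mul ![(x : Ultrapower), (y : Ultrapower)] := by
  rw [coe_funMap]
  congr 1

theorem exists_coe_eq_germ (x : cut a ha) : ∃ f, (x : Ultrapower) = germ f :=
  exists_eq_germ x

/-! ### Robinson arithmetic in a cut -/

theorem realize_of_robinsonQ {M : Type*} [arith.Structure M]
    (succ_inj : ∀ x y : M, Structure.funMap (L := arith) Func.succ ![x] =
      Structure.funMap (L := arith) Func.succ ![y] → x = y)
    (ne_zero : ∀ x : M, x ≠ Structure.funMap (L := arith) Func.zero ![] ↔
      ∃ y, x = Structure.funMap (L := arith) Func.succ ![y])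
    (le : ∀ x y : M, Structure.RelMap (L := arith) Rel.le ![x, y] ↔
      ∃ z, Structure.funMap (L := arith) Func.add ![z, x] = y)
    (add_zero : ∀ x : M, Structure.funMap (L := arith) Func.add
      ![x, Structure.funMap (L := arith) Func.zero ![] ] = x)
    (add_succ : ∀ x y : M, Structure.funMap (L := arith) Func.add
      ![x, Structure.funMap (L := arith) Func.succ ![y] ] =
        Structure.funMap (L := arith) Func.succ ![Structure.funMap (L := arith) Func.add ![x, y] ])
    (mul_zero : ∀ x : M, Structure.funMap (L := arith) Func.mul
      ![x, Structure.funMap (L := arith) Func.zero ![] ] =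
        Structure.funMap (L := arith) Func.zero ![])
    (mul_succ : ∀ x y : M, Structure.funMap (L := arith) Func.mul
      ![x, Structure.funMap (L := arith) Func.succ ![y] ] =
        Structure.funMap (L := arith) Func.add ![Structure.funMap (L := arith) Func.mul ![x, y], x])
    {ψ : arith.Sentence} (h : RobinsonQ ψ) : M ⊨ ψ := by
  cases h
  all_goals
    simp only [Sentence.Realize, Formula.Realize, succ, add, mul, Arithmetic.le,
      BoundedFormula.realize_all, BoundedFormula.realize_ex, BoundedFormula.realize_imp,
      BoundedFormula.realize_not, BoundedFormula.realize_iff, BoundedFormula.realize_bdEqual,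
      BoundedFormula.realize_rel₂, Term.realize_functions_apply₁, Term.realize_functions_apply₂,
      realize_zero]
  · exact succ_inj
  · exact ne_zero
  · exact le
  · exact add_zero
  · exact add_succ
  · exact mul_zero
  · exact mul_succ

theorem cut_realize_robinsonQ {ψ : arith.Sentence} (h : RobinsonQ ψ) : cut a ha ⊨ ψ := by
  refine realize_of_robinsonQ ?_ ?_ ?_ ?_ ?_ ?_ ?_ h
  · intro x y h
    obtain ⟨f, hf⟩ := exists_coe_eq_germ x
    obtain ⟨g, hg⟩ := exists_coe_eq_germ y
    rw [← SetLike.coe_eq_coe, coe_succ, coe_succ, hf, hg, succ_germ, succ_germ,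
      germ_eq_germ] at h
    rw [← SetLike.coe_eq_coe, hf, hg, germ_eq_germ]
    filter_upwards [h] with n hn using by omega
  · intro x
    obtain ⟨f, hf⟩ := exists_coe_eq_germ x
    rw [Ne, ← SetLike.coe_eq_coe, hf, coe_zero, germ_eq_germ, ← Ultrafilter.eventually_not]
    constructor
    · intro h
      have hmem : germ (fun n => f n - 1) ∈ cut a ha :=
        germ_mem_cut_of_le (hf ▸ x.2) (Eventually.of_forall fun n => Nat.sub_le _ _)
      refine ⟨⟨_, hmem⟩, ?_⟩
      rw [← SetLike.coe_eq_coe, coe_succ, hf, succ_germ, germ_eq_germ]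
      filter_upwards [h] with n hn using by omega
    · rintro ⟨y, hy⟩
      obtain ⟨g, hg⟩ := exists_coe_eq_germ y
      rw [← SetLike.coe_eq_coe, coe_succ, hf, hg, succ_germ, germ_eq_germ] at hy
      filter_upwards [hy] with n hn using by omega
  · intro x y
    obtain ⟨f, hf⟩ := exists_coe_eq_germ x
    obtain ⟨g, hg⟩ := exists_coe_eq_germ y
    rw [← relMap_le_coe, hf, hg, relMap_le_germ]
    constructor
    · intro h
      have hmem : germ (fun n => g n - f n) ∈ cut a ha :=
        germ_mem_cut_of_le (hg ▸ y.2) (Eventually.of_forall fun n => Nat.sub_le _ _)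
      refine ⟨⟨_, hmem⟩, ?_⟩
      rw [← SetLike.coe_eq_coe, coe_add, hf, hg, add_germ, germ_eq_germ]
      filter_upwards [h] with n hn using by omega
    · rintro ⟨z, hz⟩
      obtain ⟨k, hk⟩ := exists_coe_eq_germ z
      rw [← SetLike.coe_eq_coe, coe_add, hf, hg, hk, add_germ, germ_eq_germ] at hz
      filter_upwards [hz] with n hn using by omega
  · intro x
    obtain ⟨f, hf⟩ := exists_coe_eq_germ x
    rw [← SetLike.coe_eq_coe, coe_add, coe_zero, hf, add_germ]
    rfl
  · intro x y
    obtain ⟨f, hf⟩ := exists_coe_eq_germ x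
    obtain ⟨g, hg⟩ := exists_coe_eq_germ y
    rw [← SetLike.coe_eq_coe, coe_add, coe_succ, coe_succ, coe_add, hf, hg, succ_germ, add_germ,
      add_germ, succ_germ]
    rfl
  · intro x
    obtain ⟨f, hf⟩ := exists_coe_eq_germ x
    rw [← SetLike.coe_eq_coe, coe_mul, coe_zero, hf, mul_germ]
    rfl
  · intro x y
    obtain ⟨f, hf⟩ := exists_coe_eq_germ x
    obtain ⟨g, hg⟩ := exists_coe_eq_germ y
    rw [← SetLike.coe_eq_coe, coe_mul, coe_succ, coe_add, coe_mul, hf, hg, succ_germ, mul_germ,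
      mul_germ, add_germ]
    rfl

/-! ### Induction in a cut -/

/-- The least `y` such that `θ(p, x, y)` is true in the standard model, and `0` if there is no such
`y`. -/
noncomputable def leastWitness {m : ℕ} (θ : arith.BoundedFormula (Fin m) 2) (p : Fin m → ℕ)
    (x : ℕ) : ℕ :=
  sInf {y | θ.Realize p ![x, y]}

theorem realize_leastWitness {m : ℕ} {θ : arith.BoundedFormula (Fin m) 2} {p : Fin m → ℕ}
    {x y : ℕ} (h : θ.Realize p ![x, y]) : θ.Realize p ![x, leastWitness θ p x] :=
  Nat.sInf_mem (s := {y | θ.Realize p ![x, y]}) ⟨y, h⟩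

theorem realize_ex_iff {M : Type*} [arith.Structure M] {m : ℕ}
    {θ : arith.BoundedFormula (Fin m) 2} {v : Fin m → M} {x : M} :
    (∃' θ).Realize v (fun _ : Fin 1 => x) ↔ ∃ y, θ.Realize v ![x, y] := by
  rw [BoundedFormula.realize_ex]
  refine exists_congr fun y => iff_of_eq (congrArg _ (funext fun i => ?_))
  fin_cases i <;> rfl

theorem realize_germ_pair {m : ℕ} (θ : arith.BoundedFormula (Fin m) 2) (p : Fin m → ℕ → ℕ)
    (f g : ℕ → ℕ) :
    θ.Realize (fun j => germ (p j)) ![germ f, germ g] ↔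
      ∀ᶠ n in (hyperfilter ℕ : Filter ℕ), θ.Realize (fun j => p j n) ![f n, g n] := by
  have h := realize_germ θ p ![f, g]
  rw [show (fun j => germ (![f, g] j)) = ![germ f, germ g] from
    funext fun i => by fin_cases i <;> rfl] at h
  rw [h]
  refine eventually_congr (Eventually.of_forall fun n =>
    iff_of_eq (congrArg _ (funext fun i => ?_)))
  fin_cases i <;> rfl

/-- If the least witnesses for `θ` at arguments up to `a i` avoid the interval from `a (i + 1)` to
some upper bound `d` of the cut, then in the cut the formula `∃ y θ(p, x, y)` is, for `p` and `x`
up to `a i`, equivalent to the bounded formula `∃ y < a (i + 1) θ(p, x, y)`. -/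
theorem realize_ex_iff_eventually {m : ℕ} {θ : arith.BoundedFormula (Fin m) 2} (hθ : IsDelta0 θ)
    {i : ℕ} {d : ℕ → ℕ}
    (hd : ∀ f, germ f ∈ cut a ha → ∀ᶠ n in (hyperfilter ℕ : Filter ℕ), f n < d n)
    (hgap : ∀ᶠ n in (hyperfilter ℕ : Filter ℕ), ∀ p x, (∀ j, p j ≤ a i n) → x ≤ a i n →
      leastWitness θ p x < a (i + 1) n ∨ d n ≤ leastWitness θ p x)
    {v : Fin m → cut a ha} {p : Fin m → ℕ → ℕ} (hv : ∀ j, (v j : Ultrapower) = germ (p j))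
    (hp : ∀ j, ∀ᶠ n in (hyperfilter ℕ : Filter ℕ), p j n ≤ a i n)
    {x : cut a ha} {f : ℕ → ℕ} (hx : (x : Ultrapower) = germ f)
    (hf : ∀ᶠ n in (hyperfilter ℕ : Filter ℕ), f n ≤ a i n) :
    (∃' θ).Realize v (fun _ : Fin 1 => x) ↔
      ∀ᶠ n in (hyperfilter ℕ : Filter ℕ),
        ∃ y < a (i + 1) n, θ.Realize (fun j => p j n) ![f n, y] := by
  have hlos : ∀ (y : cut a ha) (g : ℕ → ℕ), (y : Ultrapower) = germ g →
      (θ.Realize v ![x, y] ↔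
        ∀ᶠ n in (hyperfilter ℕ : Filter ℕ), θ.Realize (fun j => p j n) ![f n, g n]) := by
    intro y g hy
    rw [← hθ.realize_coe mem_cut_of_relMap_le, ← realize_germ_pair, ← hx, ← hy, ← funext hv]
    refine iff_of_eq (congrArg _ (funext fun i => ?_))
    fin_cases i <;> rfl
  rw [realize_ex_iff]
  constructor
  · rintro ⟨y, hy⟩
    obtain ⟨g, hg⟩ := exists_coe_eq_germ y
    filter_upwards [(hlos y g hg).1 hy, hd g (hg ▸ y.2), hgap, eventually_all.2 hp, hf] with
      n h1 h2 h3 h4 h5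
    have h6 : leastWitness θ (fun j => p j n) (f n) ≤ g n := Nat.sInf_le h1
    have h7 := h3 _ _ h4 h5
    exact ⟨leastWitness θ (fun j => p j n) (f n), by omega, realize_leastWitness h1⟩
  · intro h
    obtain ⟨g, hg⟩ : ∃ g : ℕ → ℕ, ∀ n, (∃ y < a (i + 1) n, θ.Realize (fun j => p j n) ![f n, y]) →
        g n < a (i + 1) n ∧ θ.Realize (fun j => p j n) ![f n, g n] := by
      refine ⟨fun n => leastWitness θ (fun j => p j n) (f n), fun n => ?_⟩
      rintro ⟨y, hy, hyθ⟩
      exact ⟨(Nat.sInf_le hyθ : leastWitness θ (fun j => p j n) (f n) ≤ y).trans_lt hy,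
        realize_leastWitness hyθ⟩
    have hmem : germ g ∈ cut a ha := germ_mem_cut.2 ⟨i + 1, h.mono fun n hn => (hg n hn).1.le⟩
    exact ⟨⟨_, hmem⟩, (hlos _ g rfl).2 (h.mono fun n hn => (hg n hn).2)⟩

/-- If, for arbitrarily large `i`, the least witnesses for `θ` at arguments up to `a i` avoid an
interval from `a (i + 1)` to some upper bound of the cut, then the cut satisfies induction for
`∃ y θ`. -/
theorem cut_realize_inductionAxiom {m : ℕ} {θ : arith.BoundedFormula (Fin m) 2} (hθ : IsDelta0 θ)
    (h : ∀ i₀, ∃ i ≥ i₀, ∃ d : ℕ → ℕ,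
      (∀ f, germ f ∈ cut a ha → ∀ᶠ n in (hyperfilter ℕ : Filter ℕ), f n < d n) ∧
      ∀ᶠ n in (hyperfilter ℕ : Filter ℕ), ∀ p x, (∀ j, p j ≤ a i n) → x ≤ a i n →
        leastWitness θ p x < a (i + 1) n ∨ d n ≤ leastWitness θ p x) :
    cut a ha ⊨ inductionAxiom (∃' θ) := by
  rw [realize_inductionAxiom]
  intro v h0 hsucc x
  choose p hv using fun j => exists_coe_eq_germ (v j)
  obtain ⟨f, hx⟩ := exists_coe_eq_germ x
  choose l hl using fun j => germ_mem_cut.1 (hv j ▸ (v j).2)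
  obtain ⟨l', hl'⟩ := germ_mem_cut.1 (hx ▸ x.2)
  obtain ⟨N, hN⟩ := (Set.finite_range l).bddAbove
  obtain ⟨i, hi, d, hd, hgap⟩ := h (max N l')
  have hp : ∀ j, ∀ᶠ n in (hyperfilter ℕ : Filter ℕ), p j n ≤ a i n := fun j =>
    ((hl j).and (eventually_le_of_le ha
      ((hN (Set.mem_range_self j)).trans ((le_max_left _ _).trans hi)))).mono
        fun n h => h.1.trans h.2
  have hf : ∀ᶠ n in (hyperfilter ℕ : Filter ℕ), f n ≤ a i n :=
    (hl'.and (eventually_le_of_le ha ((le_max_right _ _).trans hi))).mono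
      fun n h => h.1.trans h.2
  by_contra hcon
  rw [realize_ex_iff_eventually hθ hd hgap hv hp hx hf, ← Ultrafilter.eventually_not] at hcon
  rw [realize_ex_iff_eventually hθ hd hgap hv hp coe_zero
    (Eventually.of_forall fun _ => Nat.zero_le _)] at h0
  -- In each coordinate, take the last argument before the first failure of the bounded formula.
  let P : ℕ → ℕ → Prop := fun n z => ∃ y < a (i + 1) n, θ.Realize (fun j => p j n) ![z, y]
  have hex : ∀ n, ∃ z, ¬ P n (f n) → P n 0 → z < f n ∧ P n z ∧ ¬ P n (z + 1) := by
    intro n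
    by_cases hn : ¬ P n (f n) ∧ P n 0
    · by_contra! hno
      have : ∀ z, z ≤ f n → P n z := by
        intro z
        induction z with
        | zero => exact fun _ => hn.2
        | succ z ih => exact fun hz => (hno z).2.2 (by omega) (ih (by omega))
      exact hn.1 (this _ le_rfl)
    · exact ⟨0, fun h1 h2 => (hn ⟨h1, h2⟩).elim⟩
  choose z hz using hex
  have hz' : ∀ᶠ n in (hyperfilter ℕ : Filter ℕ), z n < f n ∧ P n (z n) ∧ ¬ P n (z n + 1) := by
    filter_upwards [hcon, h0] with n h1 h2 using hz n h1 h2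
  have hmem : germ z ∈ cut a ha :=
    germ_mem_cut_of_le (hx ▸ x.2) (hz'.mono fun n h => h.1.le)
  have hzx : ∀ᶠ n in (hyperfilter ℕ : Filter ℕ), z n ≤ a i n := by
    filter_upwards [hz', hf] with n h1 h2 using h1.1.le.trans h2
  have hzx' : ∀ᶠ n in (hyperfilter ℕ : Filter ℕ), z n + 1 ≤ a i n := by
    filter_upwards [hz', hf] with n h1 h2 using h1.1.trans_le h2
  have h1 := hsucc ⟨_, hmem⟩ ((realize_ex_iff_eventually hθ hd hgap hv hp rfl hzx).2
    (hz'.mono fun n h => h.2.1))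
  rw [realize_ex_iff_eventually hθ hd hgap hv hp (by rw [coe_succ, succ_germ]) hzx'] at h1
  obtain ⟨n, h2, h3⟩ := (h1.and hz').exists
  exact h3.2.2 h2

/-! ### Unprovability -/

theorem countable_boundedFormula :
    Countable (Σ m, arith.BoundedFormula (Fin m) 2) := by
  have hF : Countable (Σ k, arith.Functions k) := by
    refine Function.Injective.countable (β := ℕ) (f := fun F => match F with
      | ⟨_, Func.zero⟩ => 0
      | ⟨_, Func.succ⟩ => 1
      | ⟨_, Func.add⟩ => 2
      | ⟨_, Func.mul⟩ => 3) ?_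
    rintro ⟨_, _ | _⟩ ⟨_, _ | _⟩ <;> simp
  have hR : Countable (Σ k, arith.Relations k) := by
    refine Function.Injective.countable (β := ℕ) (f := fun _ => 0) ?_
    rintro ⟨_, ⟨⟩⟩ ⟨_, ⟨⟩⟩ _
    rfl
  have hS : Countable arith.Symbols := inferInstanceAs (Countable (_ ⊕ _))
  have h2 : ∀ m, Countable (arith.BoundedFormula (Fin m) 2) := fun m =>
    Function.Injective.countable (f := fun φ => (⟨2, φ⟩ : Σ k, arith.BoundedFormula (Fin m) k))
      sigma_mk_injective
  infer_instance

/-- A model of `IΣ₁` between a sequence `a₀` and a sequence `b₀` that majorizes all branches of the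
Ackermann function at `a₀`. -/
theorem exists_cut_realize_iSigma1 (a₀ b₀ : ℕ → ℕ) (h₀ : ∀ n, ack n (a₀ n) ≤ b₀ n) :
    ∃ (a : ℕ → ℕ → ℕ)
      (ha : ∀ i, ∀ᶠ n in (hyperfilter ℕ : Filter ℕ), (a i n + 1) ^ 2 ≤ a (i + 1) n),
      germ a₀ ∈ cut a ha ∧
      (∀ f, germ f ∈ cut a ha → ∀ᶠ n in (hyperfilter ℕ : Filter ℕ), f n < b₀ n) ∧
      ∀ ψ ∈ ISigma1, cut a ha ⊨ ψ := by
  have := countable_boundedFormula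
  have : Nonempty (Σ m, arith.BoundedFormula (Fin m) 2) := ⟨⟨0, ⊥⟩⟩
  obtain ⟨e, he⟩ := exists_surjective_nat (Σ m, arith.BoundedFormula (Fin m) 2)
  -- Unpairing makes each formula occur at arbitrarily large stages.
  obtain ⟨a, b, rfl, rfl, hab⟩ := exists_gap_sequences
    (fun i => ⟨(e i.unpair.1).1, leastWitness (e i.unpair.1).2⟩) a₀ b₀ h₀
  have hle : (hyperfilter ℕ : Filter ℕ) ≤ atTop := Nat.hyperfilter_le_atTop
  have ha : ∀ i, ∀ᶠ n in (hyperfilter ℕ : Filter ℕ), (a i n + 1) ^ 2 ≤ a (i + 1) n :=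
    fun i => hle ((hab i).mono fun n h => h.1)
  have hb : ∀ i j, i ≤ j → ∀ᶠ n in (hyperfilter ℕ : Filter ℕ), b j n ≤ b i n := by
    intro i j hij
    induction j, hij using Nat.le_induction with
    | base => exact Eventually.of_forall fun _ => le_rfl
    | succ j _ ih =>
      filter_upwards [ih, hle (hab j)] with n h1 h2 using h2.2.2.1.trans h1
  have hcut : ∀ k f, germ f ∈ cut a ha →
      ∀ᶠ n in (hyperfilter ℕ : Filter ℕ), f n < b k n := by
    intro k f hf
    obtain ⟨i, hi⟩ := germ_mem_cut.1 hf
    filter_upwards [hi, eventually_le_of_le ha (le_max_left i k), hle (hab (max i k)),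
      hb k (max i k) (le_max_right i k)] with n h1 h2 h3 h4
    exact ((h1.trans h2).trans_lt h3.2.1).trans_le h4
  refine ⟨a, ha, germ_mem_cut.2 ⟨0, Eventually.of_forall fun _ => le_rfl⟩, hcut 0, ?_⟩
  rintro ψ (hψ | ⟨m, φ, ⟨θ, hθ, rfl⟩, rfl⟩)
  · exact cut_realize_robinsonQ hψ
  · refine cut_realize_inductionAxiom hθ fun i₀ => ?_
    obtain ⟨t, ht⟩ := he ⟨m, θ⟩
    refine ⟨Nat.pair t i₀, Nat.right_le_pair _ _, b (Nat.pair t i₀ + 1), hcut _, ?_⟩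
    refine hle ((hab (Nat.pair t i₀)).mono fun n h => ?_)
    have h' := h.2.2.2
    dsimp only at h'
    have hi : e (Nat.unpair (Nat.pair t i₀)).1 = ⟨m, θ⟩ := by rw [Nat.unpair_pair, ht]
    rwa [hi] at h'

theorem not_proves_terminationSentence {φ : arith.Formula (Fin 3)} (hφ : IsSigma φ)
    (hdef : DefinesGoodstein φ) : ¬ Proves ISigma1 (terminationSentence φ) := by
  intro hpr
  choose s hs using exists_goodstein_ne_zero_of_lt_ack
  obtain ⟨a, ha, hmem, hlt, hmodel⟩ :=
    exists_cut_realize_iSigma1 s (fun n => ack n (s n)) fun _ => le_rfl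
  have hterm : cut a ha ⊨ terminationSentence φ := hpr.realize _ hmodel
  obtain ⟨y, hy⟩ := realize_terminationSentence.1 hterm ⟨_, hmem⟩
  obtain ⟨f, hf⟩ := exists_coe_eq_germ y
  have h1 := hφ.realize_coe mem_cut_of_relMap_le _ _ hy
  have h2 : BoundedFormula.Realize φ (fun j => germ (![s, f, fun _ => 0] j))
      (fun j => germ ((default : Fin 0 → ℕ → ℕ) j)) := by
    convert h1 using 2 with j
    fin_cases j
    · rfl
    · exact hf.symm
    · exact coe_zero.symm
  rw [realize_germ] at h2
  obtain ⟨n, h3, h4⟩ := (h2.and (hlt f (hf ▸ y.2))).exists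
  refine hs n (f n) h4.le ((hdef (s n) (f n) 0).2 ?_)
  rw [Formula.Realize]
  convert h3 using 1
  ext j
  fin_cases j <;> rfl

end Arithmetic

theorem mainTheorem4 :
    (∀ n : ℕ, ∃ i : ℕ, goodstein n i = 0) ∧
    ∀ φ : Arithmetic.arith.Formula (Fin 3),
      Arithmetic.IsSigma φ → Arithmetic.DefinesGoodstein φ →
        ¬ Arithmetic.Proves Arithmetic.ISigma1 (Arithmetic.terminationSentence φ) := by
  exact ⟨goodstein_terminates, fun _ hφ hdef => Arithmetic.not_proves_terminationSentence hφ hdef⟩
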